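/- Let $Q_n$ be the $n$-dimensional hypercube graph (vertices: binary sequences of length $n$; two vertices are adjacent if and only if they differ in exactly one position), and let $C_m$ be the cycle on $m$ vertices. For graphs $G,T,H$ let $N(G,T)$ be the number of subgraphs of $G$ isomorphic to $T$, let $\mathrm{ex}(G,T,H)$ be the maximum of $N(G',T)$ over all subgraphs $G'\subseteq G$ having no subgraph isomorphic to $H$, and let $\mathbf d(G,T,H)=\mathrm{ex}(G,T,H)/N(G,T)$. For $\ell\ge 2$ let $z_{\ell,\ell}$ be the number of copies of $C_{2\ell}$ in $Q_\ell$ whose edges use all $\ell$ directions, that is, such that for each of the $\ell$ coordinates some edge of the copy has endpoints differing in that coordinate. There is an absolute constant $\alpha>0$ such that for all integers $k\ge 2$ and $\ell\ge 2$ with $(k,\ell)\neq(2,2)$ (i.e. $C_{2\ell}\not\cong Q_k$) and all sufficiently large $n$ (depending on $k$ and $\ell$), $$\max\left\{\left(1-\frac1k\right)\frac{(\ell-1)!}{2z_{\ell,\ell}}\,(1-o(1)),\; 1-\frac{\ell}{k}\right\}\;\le\;\mathbf d(Q_n,C_{2\ell},Q_k)\;\le\;1-\alpha\,\frac{\log k}{k2^k},$$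 where the term $o(1)$ is non-negative and tends to $0$ as $n\to\infty$ with $k,\ell$ fixed. -/

import Mathlib

open Filter Topology

/-- The hypercube `Q_n`: the vertices are the binary sequences of length `n`, and two of them are
adjacent iff they differ in exactly one position. -/
def hypercube (n : ℕ) : SimpleGraph (Fin n → Bool) where
  Adj x y := hammingDist x y = 1
  symm := ⟨fun x y h => by rw [hammingDist_comm]; exact h⟩
  loopless := ⟨fun x h => by simp at h⟩

open Classical in
/-- The generalized extremal function `ex(G, T, H)`: the maximum, over all `H`-free subgraphs `G'`
of `G`, of the number `N(G', T)` of subgraphs of `G'` isomorphic to `T`. -/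
noncomputable def genEx {V U W : Type*} [Fintype V] (G : SimpleGraph V) (T : SimpleGraph U)
    (H : SimpleGraph W) : ℕ :=
  (Finset.univ.filter fun G' : G.Subgraph => H.Free G'.coe).sup fun G' => G'.coe.copyCount T

/-- The generalized Turán density `d(G, T, H) = ex(G, T, H) / N(G, T)`. -/
noncomputable def genTuranDensity {V U W : Type*} [Fintype V] (G : SimpleGraph V)
    (T : SimpleGraph U) (H : SimpleGraph W) : ℝ :=
  (genEx G T H : ℝ) / (G.copyCount T : ℝ)

/-- The set of star (flip) positions of the edges of a subgraph `S` of `Q_n`: the coordinates in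
which the two endpoints of some edge of `S` differ. -/
def starPositions {n : ℕ} (S : (hypercube n).Subgraph) : Set (Fin n) :=
  {i | ∃ x y, S.Adj x y ∧ x i ≠ y i}

/-- `z_{k,ℓ}`: the number of copies of the cycle `C_{2ℓ}` in `Q_k` that use exactly `k` different
star positions on their edges. -/
noncomputable def cubeCycleCount (k ℓ : ℕ) : ℕ :=
  Set.ncard {S : (hypercube k).Subgraph |
    Nonempty (SimpleGraph.cycleGraph (2 * ℓ) ≃g S.coe) ∧ (starPositions S).ncard = k}

/-!
All densities are computed with labelled copies, the automorphisms of `T` cancelling out.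

Upper bound. Let `G'` be a `Q_k`-free subgraph of `Q_n`. In each copy of `Q_{k+2}`, fixing two
coordinates `i ≠ j` to distinct values leaves a copy of `Q_k`, which contains an edge missing from
`G'`; so the tail vertices of the missing oriented edges separate the `k + 2` coordinates, and at
least `log₂ (k + 2)` oriented edges are missing. As `Q_n` is arc-transitive, averaging shows that
a proportion at least `log k / (2 ^ (k + 2) * (k + 2))` of its edges is missing from `G'`, and, for
a fixed edge of `C_{2ℓ}`, the same proportion of the copies of `C_{2ℓ}` maps it to a missing edge.

Lower bounds. A copy of `Q_k` in `Q_n` is a subcube, whose edges meet `k` consecutive levels, so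
deleting the edges of all levels in one residue class modulo `k` leaves a `Q_k`-free graph. If a
set `X` of copies of `T` only contains copies with edges on at most `t` levels, the best residue
class spares a proportion `1 - t / k` of `X`. A `2ℓ`-cycle changes each of its directions at least
twice, hence has at most `ℓ` directions and at most `ℓ` levels: this gives `1 - ℓ / k`. For the
other bound, with `ℓ ≥ 3`, take for `X` the cycles lying on a single level. The zigzag cycles
`{0}, {0, 1}, {1}, …, {ℓ - 1}, {ℓ - 1, 0}` in the `ℓ`-dimensional subcubes give
`n (n - 1) ⋯ (n - ℓ + 1) 2 ^ (n - ℓ + 1)` labelled ones, while the total number of labelled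
`2ℓ`-cycles is asymptotically at most `2 ^ (n - ℓ) (n choose ℓ) z_{ℓ,ℓ} 4ℓ`, since those with fewer
than `ℓ` directions are negligible. For `ℓ = 2` the bound `1 - ℓ / k` is the larger one.
-/

open SimpleGraph

section LabelledCopies

variable {V U W : Type*}

instance finite_copy [Finite U] [Finite V] (T : SimpleGraph U) (G : SimpleGraph V) :
    Finite (Copy T G) := DFunLike.finite _

instance finite_graphIso [Finite U] [Finite V] (T : SimpleGraph U) (G : SimpleGraph V) :
    Finite (T ≃g G) := DFunLike.finite _

theorem card_aut_pos [Finite U] (T : SimpleGraph U) : 0 < Nat.card (T ≃g T) :=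
  Nat.card_pos_iff.2 ⟨⟨Iso.refl⟩, inferInstance⟩

/-- The labelled copy of `T` in `G` that arises from an isomorphism of `T` with a subgraph. -/
def copyOfSubgraphIso {T : SimpleGraph U} {G : SimpleGraph V} {S : G.Subgraph} (e : T ≃g S.coe) :
    Copy T G :=
  S.coeCopy.comp e.toCopy

theorem toSubgraph_copyOfSubgraphIso {T : SimpleGraph U} {G : SimpleGraph V} {S : G.Subgraph}
    (e : T ≃g S.coe) : (copyOfSubgraphIso e).toSubgraph = S := by
  change Subgraph.map (S.hom.comp e.toHom) ⊤ = S
  simp [Subgraph.map_comp]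

theorem copyOfSubgraphIso_trans_injective {T : SimpleGraph U} {G : SimpleGraph V} {S : G.Subgraph}
    (e : T ≃g S.coe) :
    Function.Injective fun φ : T ≃g T => copyOfSubgraphIso (φ.trans e) := fun _ _ h =>
  DFunLike.ext _ _ fun a => e.injective (Subtype.ext (DFunLike.congr_fun h a))

theorem ncard_copy_toSubgraph (T : SimpleGraph U) (G : SimpleGraph V)
    (P : G.Subgraph → Prop) :
    {f : Copy T G | P f.toSubgraph}.ncard =
      {S : G.Subgraph | Nonempty (T ≃g S.coe) ∧ P S}.ncard * Nat.card (T ≃g T) := by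
  rw [← Nat.card_coe_set_eq, ← Nat.card_coe_set_eq, ← Nat.card_prod, eq_comm]
  let e (S : {S : G.Subgraph | Nonempty (T ≃g S.coe) ∧ P S}) : T ≃g S.1.coe := S.2.1.some
  let F (p : {S : G.Subgraph | Nonempty (T ≃g S.coe) ∧ P S} × (T ≃g T)) : Copy T G :=
    copyOfSubgraphIso (p.2.trans (e p.1))
  have hF p : (F p).toSubgraph = p.1.1 := toSubgraph_copyOfSubgraphIso _
  refine Nat.card_congr (Equiv.ofBijective (fun p => ⟨F p, ?_⟩) ⟨?_, ?_⟩)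
  · change P _
    rw [hF]
    exact p.1.2.2
  · rintro ⟨S, φ⟩ ⟨S', ψ⟩ h
    have hFF : F (S, φ) = F (S', ψ) := congrArg Subtype.val h
    obtain rfl : S = S' := Subtype.ext (by rw [← hF (S, φ), ← hF (S', ψ), hFF])
    exact congrArg _ (copyOfSubgraphIso_trans_injective (e S) hFF)
  · rintro ⟨f, hf⟩
    let S : {S : G.Subgraph | Nonempty (T ≃g S.coe) ∧ P S} :=
      ⟨f.toSubgraph, ⟨f.isoToSubgraph⟩, hf⟩
    refine ⟨(S, f.isoToSubgraph.trans (e S).symm), Subtype.ext (Copy.ext fun a => ?_)⟩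
    exact congrArg Subtype.val ((e S).apply_symm_apply (f.isoToSubgraph a))

theorem copyCount_mul_card_aut [Fintype V] (T : SimpleGraph U) (G : SimpleGraph V) :
    G.copyCount T * Nat.card (T ≃g T) = Nat.card (Copy T G) := by
  classical
  have h := ncard_copy_toSubgraph T G fun _ => True
  rw [Set.ofPred_true, Set.ncard_univ] at h
  rw [h, copyCount, ← Set.ncard_coe_finset]
  simp

/-- The labelled copies of `T` in `G` all of whose edges lie in the subgraph `G'`. -/
def copiesIn {G : SimpleGraph V} (G' : G.Subgraph) (T : SimpleGraph U) : Set (Copy T G) :=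
  {f | ∀ a b, T.Adj a b → G'.Adj (f a) (f b)}

/-- The labelled copies of `T` in `G` with all edges in `G'` are the labelled copies of `T` in
`G'`, as soon as `T` has no isolated vertices. -/
def copiesInEquiv {T : SimpleGraph U} (hT : ∀ a, ∃ b, T.Adj a b) {G : SimpleGraph V}
    (G' : G.Subgraph) : copiesIn G' T ≃ Copy T G'.coe where
  toFun f :=
    ⟨⟨fun a => ⟨f.1 a, (hT a).elim fun b hab => G'.edge_vert (f.2 a b hab)⟩,
      fun {a b} hab => f.2 a b hab⟩, fun _ _ h => f.1.injective (congrArg Subtype.val h)⟩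
  invFun f := ⟨G'.coeCopy.comp f, fun _ _ h => f.toHom.map_adj h⟩
  left_inv _ := rfl
  right_inv _ := rfl

theorem copyCount_coe_mul_card_aut {T : SimpleGraph U}
    (hT : ∀ a, ∃ b, T.Adj a b) {G : SimpleGraph V} (G' : G.Subgraph) [Fintype G'.verts] :
    G'.coe.copyCount T * Nat.card (T ≃g T) = (copiesIn G' T).ncard := by
  rw [copyCount_mul_card_aut, ← Nat.card_coe_set_eq, Nat.card_congr (copiesInEquiv hT G')]

theorem copyCount_le_genEx [Fintype V] {G : SimpleGraph V} (T : SimpleGraph U)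
    {H : SimpleGraph W} (G' : G.Subgraph) [Fintype G'.verts] (h : H.Free G'.coe) :
    G'.coe.copyCount T ≤ genEx G T H := by
  classical
  have hmem : G' ∈ Finset.univ.filter fun G' : G.Subgraph => H.Free G'.coe :=
    Finset.mem_filter.2 ⟨Finset.mem_univ G', h⟩
  refine le_trans (le_of_eq ?_) (Finset.le_sup (f := fun G' => G'.coe.copyCount T) hmem)
  convert rfl

theorem genEx_le [Fintype V] {G : SimpleGraph V} {T : SimpleGraph U} {H : SimpleGraph W} {N : ℕ}
    (hN : ∀ (G' : G.Subgraph) [Fintype G'.verts], H.Free G'.coe → G'.coe.copyCount T ≤ N) :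
    genEx G T H ≤ N := by
  classical
  exact Finset.sup_le fun G' hG' => hN G' (Finset.mem_filter.1 hG').2

theorem le_genTuranDensity [Finite U] [Fintype V] {G : SimpleGraph V} {T : SimpleGraph U}
    (hT : ∀ a, ∃ b, T.Adj a b) {H : SimpleGraph W} (G' : G.Subgraph) (h : H.Free G'.coe) :
    ((copiesIn G' T).ncard : ℝ) / Nat.card (Copy T G) ≤ genTuranDensity G T H := by
  classical
  have hA : (Nat.card (T ≃g T) : ℝ) ≠ 0 := Nat.cast_ne_zero.2 (card_aut_pos T).ne'
  rw [genTuranDensity, ← copyCount_mul_card_aut, ← copyCount_coe_mul_card_aut hT, Nat.cast_mul,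
    Nat.cast_mul, mul_div_mul_right _ _ hA]
  gcongr
  exact copyCount_le_genEx T G' h

theorem genTuranDensity_le [Finite U] [Fintype V] {G : SimpleGraph V} {T : SimpleGraph U}
    (hT : ∀ a, ∃ b, T.Adj a b) {H : SimpleGraph W} {c : ℝ} (hc : 0 ≤ c)
    (hG : ∀ G' : G.Subgraph, H.Free G'.coe →
      ((copiesIn G' T).ncard : ℝ) ≤ c * Nat.card (Copy T G)) :
    genTuranDensity G T H ≤ c := by
  refine div_le_of_le_mul₀ (Nat.cast_nonneg _) hc ?_
  have hbound : 0 ≤ c * (G.copyCount T : ℝ) := by positivity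
  refine (Nat.le_floor_iff hbound).1 (genEx_le fun G' _ hfree => (Nat.le_floor_iff hbound).2 ?_)
  have hA : 0 < (Nat.card (T ≃g T) : ℝ) := Nat.cast_pos.2 (card_aut_pos T)
  refine le_of_mul_le_mul_right ?_ hA
  rw [mul_assoc, ← Nat.cast_mul, ← Nat.cast_mul, copyCount_coe_mul_card_aut hT,
    copyCount_mul_card_aut]
  exact hG G' hfree

end LabelledCopies

section ArcTransitive

variable {V U W : Type*}

theorem ncard_preimage_mul_card {α β : Type*} [Finite α] [Finite β] {p : α → β}
    (hp : ∀ b b', (p ⁻¹' {b}).ncard = (p ⁻¹' {b'}).ncard) (D : Set β) :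
    (p ⁻¹' D).ncard * Nat.card β = D.ncard * Nat.card α := by
  rcases isEmpty_or_nonempty β with hβ | ⟨⟨b₀⟩⟩
  · have := p.isEmpty
    simp
  have key (E : Set β) : (p ⁻¹' E).ncard = E.ncard * (p ⁻¹' {b₀}).ncard := by
    rw [← Set.biUnion_preimage_singleton, E.toFinite.ncard_biUnion (fun _ _ => Set.toFinite _)
      (Set.pairwiseDisjoint_fiber p E), finsum_mem_congr rfl fun b _ => hp b b₀,
      finsum_mem_eq_finite_toFinset_sum _ E.toFinite, Finset.sum_const, smul_eq_mul,
      ← Set.ncard_eq_toFinset_card]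
  have hα := key Set.univ
  rw [Set.preimage_univ, Set.ncard_univ, Set.ncard_univ] at hα
  rw [key D, hα]
  ring

/-- Any oriented edge of `G` can be moved to any other by an automorphism. -/
def IsArcTransitive (G : SimpleGraph V) : Prop :=
  ∀ ⦃x y x' y'⦄, G.Adj x y → G.Adj x' y' → ∃ g : G ≃g G, g x = x' ∧ g y = y'

/-- The oriented edges of `G` that are missing from the subgraph `G'`. -/
def missingDarts {G : SimpleGraph V} (G' : G.Subgraph) : Set G.Dart :=
  {d | ¬ G'.Adj d.fst d.snd}

theorem exists_mapDart_mem_missingDarts {G : SimpleGraph V} {G' : G.Subgraph} {H : SimpleGraph W}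
    (hH : ∀ a, ∃ b, H.Adj a b) (hfree : H.Free G'.coe) (ψ : Copy H G) :
    ∃ d, ψ.toHom.mapDart d ∈ missingDarts G' := by
  by_contra! h
  exact hfree ⟨copiesInEquiv hH G' ⟨ψ, fun a b hab => not_not.1 (h ⟨(a, b), hab⟩)⟩⟩

instance finite_dart [Finite V] (G : SimpleGraph V) : Finite G.Dart :=
  Finite.of_injective _ Dart.toProd_injective

namespace IsArcTransitive

variable {G : SimpleGraph V} (hG : IsArcTransitive G)
include hG

theorem ncard_mapDart_mem_mul_card [Finite V] [Finite U] {T : SimpleGraph U} (d : T.Dart)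
    (D : Set G.Dart) :
    {f : Copy T G | f.toHom.mapDart d ∈ D}.ncard * Nat.card G.Dart =
      D.ncard * Nat.card (Copy T G) := by
  refine ncard_preimage_mul_card (p := fun f : Copy T G => f.toHom.mapDart d) ?_ D
  suffices h : ∀ e e' : G.Dart, {f : Copy T G | f.toHom.mapDart d = e}.ncard ≤
      {f : Copy T G | f.toHom.mapDart d = e'}.ncard from fun e e' => (h e e').antisymm (h e' e)
  intro e e'
  obtain ⟨g, hfst, hsnd⟩ := hG e.adj e'.adj
  refine Set.ncard_le_ncard_of_injOn (fun f => g.toCopy.comp f) ?_ ?_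
  · rintro f rfl
    exact Dart.ext _ _ (Prod.ext hfst hsnd)
  · exact fun f _ f' _ h => Copy.ext fun a => g.injective (DFunLike.congr_fun h a)

theorem ncard_missingDarts_mul_card_copy_le [Finite V] [Finite U] {T : SimpleGraph U}
    (d : T.Dart) (G' : G.Subgraph) :
    (missingDarts G').ncard * Nat.card (Copy T G) ≤
      (copiesIn G' T)ᶜ.ncard * Nat.card G.Dart := by
  rw [← hG.ncard_mapDart_mem_mul_card d]
  refine Nat.mul_le_mul_right _ (Set.ncard_le_ncard fun f hf hmem => hf ?_)
  exact hmem _ _ d.adj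

theorem mul_card_dart_le [Finite V] [Finite U] {F : SimpleGraph U} [Nonempty (Copy F G)]
    {G' : G.Subgraph} {c : ℝ}
    (hc : ∀ φ : Copy F G, c ≤ {d | φ.toHom.mapDart d ∈ missingDarts G'}.ncard) :
    c * Nat.card G.Dart ≤ Nat.card F.Dart * (missingDarts G').ncard := by
  classical
  cases nonempty_fintype (Copy F G)
  cases nonempty_fintype F.Dart
  let R (φ : Copy F G) (d : F.Dart) : Prop := φ.toHom.mapDart d ∈ missingDarts G'
  have hdouble : ∑ φ, {d | R φ d}.ncard = ∑ d, {φ | R φ d}.ncard := by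
    simpa only [Set.ncard_eq_toFinset_card', Set.toFinset_ofPred, Finset.bipartiteAbove,
      Finset.bipartiteBelow] using
      Finset.sum_card_bipartiteAbove_eq_sum_card_bipartiteBelow R (s := .univ) (t := .univ)
  have hcopies : (0 : ℝ) < Nat.card (Copy F G) := Nat.cast_pos.2 Nat.card_pos
  refine le_of_mul_le_mul_left ?_ hcopies
  calc (Nat.card (Copy F G) : ℝ) * (c * Nat.card G.Dart)
      = (∑ _φ : Copy F G, c) * Nat.card G.Dart := by
        rw [Finset.sum_const, nsmul_eq_mul, Nat.card_eq_fintype_card, Finset.card_univ, mul_assoc]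
    _ ≤ (∑ φ, ({d | R φ d}.ncard : ℝ)) * Nat.card G.Dart := by gcongr with φ; exact hc φ
    _ = ∑ d, ({φ | R φ d}.ncard * Nat.card G.Dart : ℝ) := by
        rw [← Finset.sum_mul, ← Nat.cast_sum, hdouble, Nat.cast_sum]
    _ = ∑ _d : F.Dart, ((missingDarts G').ncard * Nat.card (Copy F G) : ℝ) :=
        Finset.sum_congr rfl fun d _ => by
          exact_mod_cast hG.ncard_mapDart_mem_mul_card d (missingDarts G')
    _ = Nat.card (Copy F G) * (Nat.card F.Dart * (missingDarts G').ncard) := by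
        rw [Finset.sum_const, nsmul_eq_mul, Finset.card_univ, ← Nat.card_eq_fintype_card]
        ring

theorem genTuranDensity_le {U' : Type*} [Fintype V] [Finite U] [Finite U'] [Nonempty U]
    {T : SimpleGraph U} (hT : ∀ a, ∃ b, T.Adj a b) {F : SimpleGraph U'} [Nonempty (Copy F G)]
    {H : SimpleGraph W} {c : ℝ} (hcF : c ≤ Nat.card F.Dart)
    (hc : ∀ G' : G.Subgraph, H.Free G'.coe → ∀ φ : Copy F G,
      c ≤ {d | φ.toHom.mapDart d ∈ missingDarts G'}.ncard) :
    genTuranDensity G T H ≤ 1 - c / Nat.card F.Dart := by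
  have hF : (0 : ℝ) ≤ Nat.card F.Dart := Nat.cast_nonneg _
  refine _root_.genTuranDensity_le hT (sub_nonneg.2 (div_le_one_of_le₀ hcF hF)) fun G' hfree => ?_
  rcases isEmpty_or_nonempty (Copy T G) with hcopy | ⟨⟨f⟩⟩
  · simp [Set.eq_empty_of_isEmpty]
  obtain ⟨a⟩ := ‹Nonempty U›
  obtain ⟨b, hab⟩ := hT a
  have hdarts : (0 : ℝ) < Nat.card G.Dart := by
    have : Nonempty G.Dart := ⟨f.toHom.mapDart ⟨(a, b), hab⟩⟩
    exact_mod_cast Nat.card_pos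
  have hmissing : ((missingDarts G').ncard * Nat.card (Copy T G) : ℝ) ≤
      (copiesIn G' T)ᶜ.ncard * Nat.card G.Dart := by
    exact_mod_cast hG.ncard_missingDarts_mul_card_copy_le ⟨(a, b), hab⟩ G'
  have hcompl : ((copiesIn G' T).ncard + (copiesIn G' T)ᶜ.ncard : ℝ) = Nat.card (Copy T G) := by
    exact_mod_cast Set.ncard_add_ncard_compl (copiesIn G' T)
  have hprop : c / Nat.card F.Dart * Nat.card G.Dart ≤ (missingDarts G').ncard := by
    rw [div_mul_eq_mul_div]
    refine div_le_of_le_mul₀ hF (Nat.cast_nonneg _) ?_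
    rw [mul_comm ((missingDarts G').ncard : ℝ)]
    exact hG.mul_card_dart_le (hc G' hfree)
  have hfew : c / Nat.card F.Dart * Nat.card (Copy T G) ≤ (copiesIn G' T)ᶜ.ncard := by
    refine le_of_mul_le_mul_right ?_ hdarts
    rw [mul_right_comm]
    exact (mul_le_mul_of_nonneg_right hprop (Nat.cast_nonneg _)).trans hmissing
  linarith

end IsArcTransitive

end ArcTransitive

/-- Flip the `i`-th bit of `x`. -/
def flipBit {n : ℕ} (x : Fin n → Bool) (i : Fin n) : Fin n → Bool :=
  Function.update x i (!x i)

section FlipBit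

variable {n : ℕ} (x : Fin n → Bool)

@[simp]
theorem flipBit_self (i : Fin n) : flipBit x i i = !x i := Function.update_self ..

theorem flipBit_of_ne {i j : Fin n} (h : j ≠ i) : flipBit x i j = x j :=
  Function.update_of_ne h ..

theorem flipBit_apply (i j : Fin n) : flipBit x i j = if j = i then !x j else x j := by
  split_ifs with h
  · rw [h, flipBit_self]
  · rw [flipBit_of_ne x h]

@[simp]
theorem flipBit_flipBit (i : Fin n) : flipBit (flipBit x i) i = x := by
  simp [flipBit]

theorem flipBit_comm (i j : Fin n) : flipBit (flipBit x i) j = flipBit (flipBit x j) i := by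
  ext m
  simp only [flipBit_apply]
  split_ifs <;> rfl

theorem flipBit_apply_ne_iff {i j : Fin n} : flipBit x i j ≠ x j ↔ j = i := by
  by_cases h : j = i <;> simp [flipBit_apply, h]

theorem flipBit_injective : Function.Injective (flipBit x) := fun i j h => by
  rw [← flipBit_apply_ne_iff x, ← h, flipBit_self]
  exact Bool.not_ne_self _

theorem hypercube_adj_iff {x y : Fin n → Bool} :
    (hypercube n).Adj x y ↔ ∃ i, y = flipBit x i := by
  change hammingDist x y = 1 ↔ _
  rw [hammingDist, Finset.card_eq_one]
  refine exists_congr fun i => ?_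
  simp only [Finset.ext_iff, Finset.mem_filter_univ, Finset.mem_singleton, funext_iff]
  refine forall_congr' fun m => ?_
  rw [flipBit_apply]
  split_ifs with hm <;> cases x m <;> cases y m <;> simp [hm]

theorem hypercube_adj_flipBit (i : Fin n) : (hypercube n).Adj x (flipBit x i) :=
  hypercube_adj_iff.2 ⟨i, rfl⟩

theorem exists_hypercube_adj (hn : 0 < n) : ∃ y, (hypercube n).Adj x y :=
  ⟨_, hypercube_adj_flipBit x ⟨0, hn⟩⟩

theorem card_hypercube_dart (n : ℕ) : Nat.card (hypercube n).Dart = 2 ^ n * n := by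
  let F (p : (Fin n → Bool) × Fin n) : (hypercube n).Dart :=
    ⟨(p.1, flipBit p.1 p.2), hypercube_adj_flipBit p.1 p.2⟩
  have hF : Function.Bijective F := by
    refine ⟨?_, ?_⟩
    · rintro ⟨x, i⟩ ⟨y, j⟩ h
      obtain rfl : x = y := congrArg (·.fst) h
      exact Prod.ext rfl (flipBit_injective x (congrArg (·.snd) h))
    · intro d
      obtain ⟨i, hi⟩ := hypercube_adj_iff.1 d.adj
      exact ⟨(d.fst, i), Dart.ext _ _ (Prod.ext rfl hi.symm)⟩
  rw [← Nat.card_eq_of_bijective F hF]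
  simp

/-- The automorphism of the hypercube that permutes the coordinates and adds `a`. -/
def hypercubeAut (σ : Equiv.Perm (Fin n)) (a : Fin n → Bool) : hypercube n ≃g hypercube n where
  toFun x m := xor (x (σ m)) (a m)
  invFun x m := xor (x (σ.symm m)) (a (σ.symm m))
  left_inv x := by ext m; simp
  right_inv x := by ext m; simp
  map_rel_iff' {x y} := by
    refine iff_of_eq (congrArg (· = 1) ?_)
    exact Finset.card_equiv σ fun i => by simp

theorem isArcTransitive_hypercube (n : ℕ) : IsArcTransitive (hypercube n) := by
  intro x y x' y' h h'
  obtain ⟨i, rfl⟩ := hypercube_adj_iff.1 h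
  obtain ⟨i', rfl⟩ := hypercube_adj_iff.1 h'
  refine ⟨hypercubeAut (Equiv.swap i i') fun m => xor (x (Equiv.swap i i' m)) (x' m), ?_, ?_⟩
  · ext m
    change xor _ (xor _ _) = _
    simp
  · ext m
    change xor (flipBit x i _) (xor _ _) = _
    have hswap : Equiv.swap i i' m = i ↔ m = i' := by
      rw [Equiv.swap_apply_eq_iff, Equiv.swap_apply_left]
    simp only [flipBit_apply, hswap]
    split_ifs <;> simp

end FlipBit

section Subcube

variable {a b : ℕ} (e : Fin a ↪ Fin b) (x : Fin b → Bool)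

theorem extend_flipBit (w : Fin a → Bool) (i : Fin a) :
    Function.extend e (flipBit w i) x = flipBit (Function.extend e w x) (e i) := by
  ext m
  rw [flipBit_apply]
  by_cases hm : ∃ j, e j = m
  · obtain ⟨j, rfl⟩ := hm
    simp [e.injective.extend_apply, flipBit_apply, e.injective.eq_iff]
  · have hne : m ≠ e i := fun h => hm ⟨i, h.symm⟩
    simp [Function.extend_apply' _ _ _ hm, hne]

theorem extend_extend (v w : Fin a → Bool) :
    Function.extend e v (Function.extend e w x) = Function.extend e v x := by
  ext m
  by_cases hm : ∃ j, e j = m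
  · obtain ⟨j, rfl⟩ := hm
    simp [e.injective.extend_apply]
  · simp [Function.extend_apply' _ _ _ hm]

theorem extend_comp_self : Function.extend e (x ∘ e) x = x := by
  ext m
  by_cases hm : ∃ j, e j = m
  · obtain ⟨j, rfl⟩ := hm
    simp [e.injective.extend_apply]
  · simp [Function.extend_apply' _ _ _ hm]

/-- The embedding of `Q_a` as a subcube of `Q_b` spanned by the coordinates in the range of `e`,
with the remaining coordinates fixed as in `x`. -/
noncomputable def subcubeCopy : Copy (hypercube a) (hypercube b) where
  toHom :=
    { toFun w := Function.extend e w x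
      map_rel' h := by
        obtain ⟨i, rfl⟩ := hypercube_adj_iff.1 h
        exact hypercube_adj_iff.2 ⟨e i, extend_flipBit e x _ i⟩ }
  injective' := Function.extend_injective e.injective x

theorem subcubeCopy_apply (w : Fin a → Bool) : subcubeCopy e x w = Function.extend e w x := rfl

end Subcube

section UpperBound

variable {n k : ℕ} {G' : (hypercube n).Subgraph}

theorem exists_missingDart_separating (hk : 0 < k) (hfree : (hypercube k).Free G'.coe)
    (φ : Copy (hypercube (k + 2)) (hypercube n)) {i j : Fin (k + 2)} (hij : i ≠ j) :
    ∃ d, φ.toHom.mapDart d ∈ missingDarts G' ∧ d.fst i ≠ d.fst j := by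
  have hcard : ({i, j}ᶜ : Finset (Fin (k + 2))).card = k := by
    rw [Finset.card_compl, Finset.card_pair hij, Fintype.card_fin, Nat.add_sub_cancel]
  let e : Fin k ↪ Fin (k + 2) := (Finset.orderEmbOfFin _ hcard).toEmbedding
  have he {m} (hm : m = i ∨ m = j) : ¬ ∃ a, e a = m := by
    rintro ⟨a, rfl⟩
    have hmem : e a ∈ ({i, j}ᶜ : Finset (Fin (k + 2))) := Finset.orderEmbOfFin_mem _ hcard a
    rw [Finset.mem_compl, Finset.mem_insert, Finset.mem_singleton] at hmem
    exact hmem hm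
  let ι := subcubeCopy e fun m => decide (m = j)
  obtain ⟨d, hd⟩ :=
    exists_mapDart_mem_missingDarts (exists_hypercube_adj · hk) hfree (φ.comp ι)
  refine ⟨ι.toHom.mapDart d, hd, ?_⟩
  change ι d.fst i ≠ ι d.fst j
  simp [ι, subcubeCopy_apply, Function.extend_apply' _ _ _ (he (.inl rfl)),
    Function.extend_apply' _ _ _ (he (.inr rfl)), hij]

theorem add_two_le_two_pow_ncard_missing (hk : 0 < k) (hfree : (hypercube k).Free G'.coe)
    (φ : Copy (hypercube (k + 2)) (hypercube n)) :
    k + 2 ≤ 2 ^ {d | φ.toHom.mapDart d ∈ missingDarts G'}.ncard := by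
  let sep (i : Fin (k + 2)) (d : {d | φ.toHom.mapDart d ∈ missingDarts G'}) : Bool := d.1.fst i
  have hsep : Function.Injective sep := fun i j hij => by
    by_contra hne
    obtain ⟨d, hd, hdij⟩ := exists_missingDart_separating hk hfree φ hne
    exact hdij (congrFun hij ⟨d, hd⟩)
  have hcard := Nat.card_le_card_of_injective sep hsep
  rwa [Nat.card_fun, Nat.card_coe_set_eq, Nat.card_fin, Nat.card_eq_fintype_card,
    Fintype.card_bool] at hcard

theorem log_le_ncard_missing (hk : 0 < k) (hfree : (hypercube k).Free G'.coe)
    (φ : Copy (hypercube (k + 2)) (hypercube n)) :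
    Real.log k ≤ {d | φ.toHom.mapDart d ∈ missingDarts G'}.ncard := by
  have h := add_two_le_two_pow_ncard_missing hk hfree φ
  set M := {d | φ.toHom.mapDart d ∈ missingDarts G'}.ncard
  calc Real.log k ≤ Real.log (2 ^ M : ℕ) :=
        Real.log_le_log (by exact_mod_cast hk) (by exact_mod_cast by omega)
    _ = M * Real.log 2 := by push_cast; rw [Real.log_pow]
    _ ≤ M * 1 := by gcongr; linarith [Real.log_two_lt_d9]
    _ = M := mul_one _

theorem genTuranDensity_hypercube_le {U : Type*} [Finite U] [Nonempty U] {T : SimpleGraph U}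
    (hT : ∀ a, ∃ b, T.Adj a b) (hk : 2 ≤ k) (hn : k + 2 ≤ n) :
    genTuranDensity (hypercube n) T (hypercube k) ≤
      1 - 1 / 8 * (Real.log k / (k * 2 ^ k)) := by
  have hk2 : (2 : ℝ) ≤ k := by exact_mod_cast hk
  have hlog : 0 ≤ Real.log k := Real.log_nonneg (by linarith)
  have hdarts : (Nat.card (hypercube (k + 2)).Dart : ℝ) = 2 ^ (k + 2) * (k + 2) := by
    exact_mod_cast card_hypercube_dart (k + 2)
  have : Nonempty (Copy (hypercube (k + 2)) (hypercube n)) :=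
    ⟨subcubeCopy (Fin.castLEEmb hn) fun _ => false⟩
  have hle : Real.log k ≤ Nat.card (hypercube (k + 2)).Dart := by
    have hpow : (1 : ℝ) ≤ 2 ^ (k + 2) := one_le_pow₀ one_le_two
    rw [hdarts]
    nlinarith [Real.log_le_self (x := k) (by positivity)]
  refine ((isArcTransitive_hypercube n).genTuranDensity_le hT hle fun G' hfree φ =>
    log_le_ncard_missing (by omega) hfree φ).trans (sub_le_sub_left ?_ 1)
  rw [hdarts, one_div_mul_eq_div, div_div]
  refine div_le_div_of_nonneg_left hlog (by positivity) ?_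
  rw [pow_add]
  nlinarith [pow_pos (zero_lt_two' ℝ) k]

end UpperBound

/-- The Hamming weight of `x`. -/
def bitWeight {n : ℕ} (x : Fin n → Bool) : ℕ := (Finset.univ.filter fun i => x i = true).card

section Weight

variable {n : ℕ}

theorem bitWeight_flipBit_of_false {x : Fin n → Bool} {i : Fin n} (h : x i = false) :
    bitWeight (flipBit x i) = bitWeight x + 1 := by
  have hsupp : (Finset.univ.filter fun j => flipBit x i j = true) =
      insert i (Finset.univ.filter fun j => x j = true) := by
    ext j
    by_cases hj : j = i <;> simp [flipBit_apply, hj, h]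
  rw [bitWeight, hsupp, Finset.card_insert_of_notMem (by simp [h]), bitWeight]

theorem bitWeight_flipBit_of_true {x : Fin n → Bool} {i : Fin n} (h : x i = true) :
    bitWeight (flipBit x i) + 1 = bitWeight x := by
  rw [← bitWeight_flipBit_of_false (by simp [h] : flipBit x i i = false), flipBit_flipBit]

theorem bitWeight_extend {m : ℕ} (e : Fin m ↪ Fin n) (x : Fin n → Bool) :
    ∃ c, ∀ w, bitWeight (Function.extend e w x) = c + bitWeight w := by
  refine ⟨(Finset.univ.filter fun i => x i = true ∧ i ∉ Set.range e).card, fun w => ?_⟩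
  have hsplit : (Finset.univ.filter fun i => Function.extend e w x i = true) =
      (Finset.univ.filter fun i => x i = true ∧ i ∉ Set.range e) ∪
        (Finset.univ.filter fun j => w j = true).map e := by
    ext i
    by_cases hi : i ∈ Set.range e
    · obtain ⟨j, rfl⟩ := hi
      simp [e.injective.extend_apply]
    · have hne j : e j ≠ i := fun h => hi ⟨j, h⟩
      simp [hne]
  rw [bitWeight, hsplit, Finset.card_union_of_disjoint, Finset.card_map, bitWeight]
  exact Finset.disjoint_left.2 fun i hi hi' => by simp_all

end Weight

section CubeInCube

variable {n k : ℕ}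

theorem eq_of_flipBit_invariant {α : Type*} {f : (Fin n → Bool) → α}
    (hf : ∀ x i, f (flipBit x i) = f x) (x y : Fin n → Bool) : f x = f y := by
  suffices h : ∀ s : Finset (Fin n), f (s.piecewise x y) = f y by
    simpa using h Finset.univ
  intro s
  induction s using Finset.induction with
  | empty => simp
  | insert i s _ ih =>
    rw [Finset.piecewise_insert]
    by_cases hi : x i = s.piecewise x y i
    · rwa [hi, Function.update_eq_self]
    · rw [Bool.eq_not_of_ne hi]
      exact (hf _ i).trans ih

theorem flipBit_parallel {x : Fin n → Bool} {a b c d : Fin n} (hab : a ≠ b) (hbc : b ≠ c)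
    (h : flipBit (flipBit x b) c = flipBit (flipBit x a) d) : c = a := by
  by_contra hca
  have hda : d ≠ a := by
    rintro rfl
    rw [flipBit_flipBit] at h
    refine hbc (flipBit_injective (flipBit x b) ?_)
    rw [h, flipBit_flipBit]
  have ha := congrFun h a
  rw [flipBit_of_ne _ (Ne.symm hca), flipBit_of_ne _ hab, flipBit_of_ne _ hda.symm,
    flipBit_self] at ha
  exact Bool.not_ne_self _ ha.symm

/-- The key point is that opposite edges of a 4-cycle in `Q_n` are parallel. -/
theorem exists_embedding_copy_flipBit (φ : Copy (hypercube k) (hypercube n)) :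
    ∃ e : Fin k ↪ Fin n, ∀ w i, φ (flipBit w i) = flipBit (φ w) (e i) := by
  choose dir hdir using fun w i =>
    hypercube_adj_iff.1 (φ.toHom.map_adj (hypercube_adj_flipBit w i))
  simp only [Copy.toHom_apply] at hdir
  have hdir_inj w : Function.Injective (dir w) := fun i j hij =>
    flipBit_injective w (φ.injective (by rw [Copy.coe_toHom, hdir, hdir, hij]))
  have hback w j : dir (flipBit w j) j = dir w j := by
    refine flipBit_injective (flipBit (φ w) (dir w j)) ?_
    rw [← hdir w j, ← hdir, flipBit_flipBit, hdir w j, flipBit_flipBit]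
  have hparallel w j : dir (flipBit w j) = dir w := by
    funext i
    by_cases hij : i = j
    · rw [hij, hback]
    refine flipBit_parallel (x := φ w) (d := dir (flipBit w i) j) ((hdir_inj w).ne hij) ?_ ?_
    · rw [← hback]
      exact (hdir_inj _).ne (Ne.symm hij)
    · rw [← hdir w j, ← hdir w i, ← hdir, ← hdir, flipBit_comm]
  have hconst := eq_of_flipBit_invariant hparallel
  exact ⟨⟨dir fun _ => false, hdir_inj _⟩, fun w i => by rw [hdir, hconst w fun _ => false]; rfl⟩

theorem exists_bitWeight_copy_add (φ : Copy (hypercube k) (hypercube n)) :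
    ∃ c, ∀ d < k, ∃ w i, bitWeight (φ w) = c + d ∧ bitWeight (φ (flipBit w i)) = c + d + 1 := by
  obtain ⟨e, he⟩ := exists_embedding_copy_flipBit φ
  obtain ⟨w₀, hw₀⟩ := Finite.exists_min fun w => bitWeight (φ w)
  have hfalse i : φ w₀ (e i) = false := by
    by_contra h
    have := bitWeight_flipBit_of_true (Bool.eq_true_of_not_eq_false h)
    have := hw₀ (flipBit w₀ i)
    rw [he] at this
    omega
  have hclimb : ∀ d ≤ k, ∃ w, bitWeight (φ w) = bitWeight (φ w₀) + d ∧
      ∀ i : Fin k, d ≤ i → φ w (e i) = false := by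
    intro d hd
    induction d with
    | zero => exact ⟨w₀, rfl, fun i _ => hfalse i⟩
    | succ d ih =>
      obtain ⟨w, hw, hwe⟩ := ih (by omega)
      refine ⟨flipBit w ⟨d, hd⟩, ?_, fun i hi => ?_⟩
      · rw [he, bitWeight_flipBit_of_false (hwe _ le_rfl), hw, add_assoc]
      · rw [he, flipBit_of_ne _ (e.injective.ne (Fin.ne_of_gt hi)), hwe i (by omega)]
  refine ⟨bitWeight (φ w₀), fun d hd => ?_⟩
  obtain ⟨w, hw, hwe⟩ := hclimb d hd.le
  refine ⟨w, ⟨d, hd⟩, hw, ?_⟩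
  rw [he, bitWeight_flipBit_of_false (hwe _ le_rfl), hw]

end CubeInCube

section Levels

variable {n : ℕ}

/-- The level of an edge `xy` of the hypercube is the weight of its lower endpoint. -/
def edgeLevel (x y : Fin n → Bool) : ℕ := min (bitWeight x) (bitWeight y)

theorem edgeLevel_comm (x y : Fin n → Bool) : edgeLevel x y = edgeLevel y x := min_comm _ _

/-- The subgraph of `Q_n` obtained by deleting all the edges whose level is `r` modulo `k`. -/
def levelSubgraph (n k r : ℕ) : (hypercube n).Subgraph where
  verts := Set.univ
  Adj x y := (hypercube n).Adj x y ∧ edgeLevel x y % k ≠ r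
  adj_sub h := h.1
  edge_vert _ := Set.mem_univ _
  symm := ⟨fun x y h => ⟨h.1.symm, edgeLevel_comm x y ▸ h.2⟩⟩

theorem levelSubgraph_adj {k r : ℕ} {x y : Fin n → Bool} :
    (levelSubgraph n k r).Adj x y ↔ (hypercube n).Adj x y ∧ edgeLevel x y % k ≠ r := Iff.rfl

theorem levelSubgraph_free {k r : ℕ} (hr : r < k) :
    (hypercube k).Free (levelSubgraph n k r).coe := by
  rintro ⟨φ⟩
  obtain ⟨c, hc⟩ := exists_bitWeight_copy_add ((levelSubgraph n k r).coeCopy.comp φ)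
  have hk : 0 < k := by omega
  have hmod : (c + (r + (k - c % k)) % k) % k = r := by
    have hck := Nat.mod_lt c hk
    rw [Nat.add_mod_mod, ← Nat.mod_add_mod, show c % k + (r + (k - c % k)) = r + k by omega,
      Nat.add_mod_right, Nat.mod_eq_of_lt hr]
  obtain ⟨w, i, hw, hwi⟩ := hc _ (Nat.mod_lt _ hk)
  refine (levelSubgraph_adj.1 (φ.toHom.map_adj (hypercube_adj_flipBit w i))).2 ?_
  refine Eq.trans ?_ hmod
  exact congrArg (· % k) ((congrArg₂ min hw hwi).trans (min_eq_left (Nat.le_succ _)))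

/-- The levels of the edges of a copy of `T` in the hypercube. -/
def edgeLevels {U : Type*} {T : SimpleGraph U} (f : Copy T (hypercube n)) : Set ℕ :=
  {w | ∃ a b, T.Adj a b ∧ edgeLevel (f a) (f b) = w}

theorem finite_edgeLevels {U : Type*} {T : SimpleGraph U} (f : Copy T (hypercube n)) :
    (edgeLevels f).Finite :=
  (Set.finite_range fun p : (Fin n → Bool) × (Fin n → Bool) => edgeLevel p.1 p.2).subset
    fun _ ⟨_, _, _, h⟩ => ⟨(f _, f _), h⟩

theorem mem_copiesIn_levelSubgraph_iff {U : Type*} {T : SimpleGraph U} {k r : ℕ}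
    {f : Copy T (hypercube n)} :
    f ∈ copiesIn (levelSubgraph n k r) T ↔ r ∉ (· % k) '' edgeLevels f := by
  constructor
  · rintro h ⟨_, ⟨a, b, hab, rfl⟩, hr⟩
    exact (levelSubgraph_adj.1 (h a b hab)).2 hr
  · exact fun h a b hab =>
      levelSubgraph_adj.2 ⟨f.toHom.map_adj hab, fun hr => h ⟨_, ⟨a, b, hab, rfl⟩, hr⟩⟩

theorem exists_ncard_diff_copiesIn_levelSubgraph_le {U : Type*} [Finite U] {T : SimpleGraph U}
    {k t : ℕ} (hk : 0 < k) {X : Set (Copy T (hypercube n))}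
    (hX : ∀ f ∈ X, (edgeLevels f).ncard ≤ t) :
    ∃ r < k, k * (X \ copiesIn (levelSubgraph n k r) T).ncard ≤ t * X.ncard := by
  classical
  lift X to Finset (Copy T (hypercube n)) using X.toFinite
  let R (f : Copy T (hypercube n)) (r : ℕ) : Prop := r ∈ (· % k) '' edgeLevels f
  have hrow f (hf : f ∈ X) : ((Finset.range k).bipartiteAbove R f).card ≤ t := by
    refine le_trans ?_ (hX f hf)
    rw [← Set.ncard_coe_finset]
    exact (Set.ncard_le_ncard (fun r hr => (Finset.mem_filter.1 hr).2)
      ((finite_edgeLevels f).image (· % k))).trans (Set.ncard_image_le (finite_edgeLevels f))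
  have hcolumn r : (X.bipartiteBelow R r).card =
      ((X : Set _) \ copiesIn (levelSubgraph n k r) T).ncard := by
    rw [← Set.ncard_coe_finset]
    congr 1
    ext f
    simp [Finset.bipartiteBelow, R, mem_copiesIn_levelSubgraph_iff]
  have hsum : ∑ r ∈ Finset.range k, k * (X.bipartiteBelow R r).card ≤
      ∑ _r ∈ Finset.range k, t * X.card := by
    rw [← Finset.mul_sum, ← Finset.sum_card_bipartiteAbove_eq_sum_card_bipartiteBelow,
      Finset.sum_const, Finset.card_range, smul_eq_mul, mul_comm t, ← smul_eq_mul X.card]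
    exact Nat.mul_le_mul_left k (Finset.sum_le_card_nsmul _ _ _ hrow)
  obtain ⟨r, hr, h⟩ := Finset.exists_le_of_sum_le (Finset.nonempty_range_iff.2 hk.ne') hsum
  exact ⟨r, Finset.mem_range.1 hr, by rwa [← hcolumn, Set.ncard_coe_finset]⟩

theorem one_sub_mul_le_genTuranDensity {U : Type*} [Finite U] {T : SimpleGraph U}
    (hT : ∀ a, ∃ b, T.Adj a b) {k t : ℕ} (hk : 0 < k) {X : Set (Copy T (hypercube n))}
    (hX : ∀ f ∈ X, (edgeLevels f).ncard ≤ t) :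
    (1 - t / k : ℝ) * (X.ncard / Nat.card (Copy T (hypercube n))) ≤
      genTuranDensity (hypercube n) T (hypercube k) := by
  obtain ⟨r, hr, h⟩ := exists_ncard_diff_copiesIn_levelSubgraph_le hk hX
  refine le_trans ?_ (le_genTuranDensity hT _ (levelSubgraph_free hr))
  rw [← mul_div_assoc]
  gcongr
  have hk' : (0 : ℝ) < k := Nat.cast_pos.2 hk
  have hdiff : (X.ncard : ℝ) ≤ (X \ copiesIn (levelSubgraph n k r) T).ncard +
      (copiesIn (levelSubgraph n k r) T).ncard := by
    exact_mod_cast Set.ncard_le_ncard_sdiff_add_ncard _ _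
  have hlost : ((X \ copiesIn (levelSubgraph n k r) T).ncard : ℝ) ≤ t / k * X.ncard := by
    rw [div_mul_eq_mul_div, le_div_iff₀' hk']
    exact_mod_cast h
  linarith

end Levels

section Directions

variable {n : ℕ} {U : Type*} {T : SimpleGraph U}

open Classical in
/-- The set of star positions of a labelled copy, i.e. of the coordinates that change along its
edges. -/
noncomputable def directions (f : Copy T (hypercube n)) : Finset (Fin n) :=
  Finset.univ.filter fun i => ∃ a b, T.Adj a b ∧ f a i ≠ f b i

theorem mem_directions {f : Copy T (hypercube n)} {i : Fin n} :
    i ∈ directions f ↔ ∃ a b, T.Adj a b ∧ f a i ≠ f b i := by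
  simp [directions]

theorem starPositions_toSubgraph (f : Copy T (hypercube n)) :
    starPositions f.toSubgraph = directions f := by
  ext i
  rw [Finset.mem_coe, mem_directions]
  constructor
  · rintro ⟨_, _, ⟨a, b, hab, rfl, rfl⟩, hi⟩
    exact ⟨a, b, hab, hi⟩
  · rintro ⟨a, b, hab, hi⟩
    exact ⟨f a, f b, ⟨a, b, hab, rfl, rfl⟩, hi⟩

theorem apply_eq_of_notMem_directions (hT : T.Preconnected) {f : Copy T (hypercube n)}
    {i : Fin n} (hi : i ∉ directions f) (a b : U) : f a i = f b i := by
  obtain ⟨p⟩ := hT a b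
  induction p with
  | nil => rfl
  | cons hadj _ ih =>
    rw [← ih]
    by_contra h
    exact hi (mem_directions.2 ⟨_, _, hadj, h⟩)

theorem bitWeight_le_add_card_directions (hT : T.Preconnected) (f : Copy T (hypercube n))
    (a b : U) : bitWeight (f b) ≤ bitWeight (f a) + (directions f).card := by
  classical
  refine (Finset.card_le_card fun i hi => ?_).trans (Finset.card_union_le _ _)
  rw [Finset.mem_filter_univ] at hi
  by_cases hdir : i ∈ directions f
  · exact Finset.mem_union_right _ hdir
  · simpa [apply_eq_of_notMem_directions hT hdir a b] using .inl hi

theorem edgeLevel_lt_max {x y : Fin n → Bool} (h : (hypercube n).Adj x y) :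
    edgeLevel x y < max (bitWeight x) (bitWeight y) := by
  obtain ⟨i, rfl⟩ := hypercube_adj_iff.1 h
  rw [edgeLevel, min_lt_max]
  cases hi : x i
  · exact (Nat.lt_of_lt_of_eq (Nat.lt_succ_self _) (bitWeight_flipBit_of_false hi).symm).ne
  · exact (Nat.lt_of_lt_of_eq (Nat.lt_succ_self _) (bitWeight_flipBit_of_true hi)).ne'

theorem ncard_edgeLevels_le [Finite U] (hT : T.Preconnected) (f : Copy T (hypercube n)) :
    (edgeLevels f).ncard ≤ (directions f).card := by
  rcases isEmpty_or_nonempty U with hU | hU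
  · simp [edgeLevels]
  obtain ⟨a₀, hmin⟩ := Finite.exists_min fun a => bitWeight (f a)
  set w := bitWeight (f a₀)
  have hsub : edgeLevels f ⊆ (Finset.Ico w (w + (directions f).card) : Finset ℕ) := by
    rintro _ ⟨a, b, hab, rfl⟩
    refine Finset.mem_coe.2 (Finset.mem_Ico.2 ⟨le_min (hmin a) (hmin b), ?_⟩)
    exact (edgeLevel_lt_max (f.toHom.map_adj hab)).trans_le
      (max_le (bitWeight_le_add_card_directions hT f a₀ a)
        (bitWeight_le_add_card_directions hT f a₀ b))
  simpa using Set.ncard_le_ncard hsub (Finset.finite_toSet _)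

theorem flipBit_comp {m : ℕ} (e : Fin m ↪ Fin n) (x : Fin n → Bool) (i : Fin m) :
    flipBit x (e i) ∘ e = flipBit (x ∘ e) i := by
  ext j
  simp [flipBit_apply, e.injective.eq_iff]

theorem exists_eq_subcubeCopy_comp (hT : T.Preconnected) (f : Copy T (hypercube n)) {m : ℕ}
    {e : Fin m ↪ Fin n} (he : ∀ i ∈ directions f, i ∈ Set.range e) (a₀ : U) :
    ∃ g : Copy T (hypercube m), f = (subcubeCopy e (f a₀)).comp g := by
  have hf a : Function.extend e (f a ∘ e) (f a₀) = f a := by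
    rw [← extend_comp_self e (f a)]
    ext i
    by_cases hi : i ∈ Set.range e
    · obtain ⟨j, rfl⟩ := hi
      simp [e.injective.extend_apply]
    · rw [Function.extend_apply' _ _ _ hi, Function.extend_apply' _ _ _ hi]
      exact apply_eq_of_notMem_directions hT (mt (he i) hi) a₀ a
  have hadj {a b} (hab : T.Adj a b) : (hypercube m).Adj (f a ∘ e) (f b ∘ e) := by
    obtain ⟨i, hi⟩ := hypercube_adj_iff.1 (f.toHom.map_adj hab)
    change f b = flipBit (f a) i at hi
    have hdir : i ∈ directions f := mem_directions.2 ⟨a, b, hab, by simp [hi]⟩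
    obtain ⟨j, rfl⟩ := he i hdir
    exact hypercube_adj_iff.2 ⟨j, by rw [hi, flipBit_comp]⟩
  exact ⟨⟨⟨fun a => f a ∘ e, hadj⟩, fun a b h => f.injective <| by
    rw [Copy.coe_toHom, ← hf a, ← hf b]; exact congrArg (Function.extend e · _) h⟩,
    Copy.ext fun a => (hf a).symm⟩

theorem directions_subcubeCopy_comp {m : ℕ} (e : Fin m ↪ Fin n) (x : Fin n → Bool)
    (g : Copy T (hypercube m)) :
    directions ((subcubeCopy e x).comp g) = (directions g).map e := by
  ext i
  simp only [mem_directions, Finset.mem_map, Copy.comp_apply, subcubeCopy_apply]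
  constructor
  · rintro ⟨a, b, hab, hi⟩
    by_cases h : ∃ j, e j = i
    · obtain ⟨j, rfl⟩ := h
      rw [e.injective.extend_apply, e.injective.extend_apply] at hi
      exact ⟨j, ⟨a, b, hab, hi⟩, rfl⟩
    · exact absurd (by rw [Function.extend_apply' _ _ _ h, Function.extend_apply' _ _ _ h]) hi
  · rintro ⟨j, ⟨a, b, hab, hj⟩, rfl⟩
    exact ⟨a, b, hab, by rwa [e.injective.extend_apply, e.injective.extend_apply]⟩

end Directions

section Counting

/-- The labelled copies of `T` in `Q_n` that use exactly `j` directions. -/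
def copiesWithDirections {U : Type*} (T : SimpleGraph U) (n j : ℕ) : Set (Copy T (hypercube n)) :=
  {f | (directions f).card = j}

variable {U : Type*} [Finite U] [Nonempty U] {T : SimpleGraph U}

theorem ncard_copiesWithDirections_mul_two_pow_le (hT : T.Preconnected) (n j : ℕ) :
    (copiesWithDirections T n j).ncard * 2 ^ j ≤
      n.choose j * (2 ^ n * (copiesWithDirections T j j).ncard) := by
  let a₀ : U := Classical.arbitrary U
  let D (f : copiesWithDirections T n j) : {D : Finset (Fin n) // D.card = j} :=
    ⟨directions f.1, f.2⟩
  let e (D : {D : Finset (Fin n) // D.card = j}) : Fin j ↪ Fin n :=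
    (D.1.orderEmbOfFin D.2).toEmbedding
  have he f : ∀ i ∈ directions f.1, i ∈ Set.range (e (D f)) := fun i hi => by
    rw [← Finset.mem_coe, ← Finset.range_orderEmbOfFin _ f.2] at hi
    exact hi
  choose g hg using fun f => exists_eq_subcubeCopy_comp hT f.1 (he f) a₀
  have hgdir f : g f ∈ copiesWithDirections T j j := by
    have h := congrArg (fun f => (directions f).card) (hg f)
    rw [directions_subcubeCopy_comp, Finset.card_map] at h
    exact h.symm.trans f.2
  let F (p : copiesWithDirections T n j × (Fin j → Bool)) :
      {D : Finset (Fin n) // D.card = j} × (Fin n → Bool) × copiesWithDirections T j j :=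
    (D p.1, Function.extend (e (D p.1)) p.2 (p.1.1 a₀), ⟨g p.1, hgdir p.1⟩)
  have hF : Function.Injective F := by
    rintro ⟨f, y⟩ ⟨f', y'⟩ h
    simp only [F, Prod.mk.injEq, Subtype.mk.injEq] at h
    obtain ⟨hD, hx, hgg⟩ := h
    rw [hD] at hx
    have hy : y = y' := by
      rw [← Function.extend_comp (e (D f')).injective y (f.1 a₀), hx, Function.extend_comp
        (e (D f')).injective]
    have hff : f.1 = f'.1 := by
      rw [hg f, hg f', hD, hgg]
      refine Copy.ext fun a => ?_
      simp only [Copy.comp_apply, subcubeCopy_apply]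
      rw [← extend_extend _ _ _ y, hx, extend_extend]
    rw [hy, Subtype.ext hff]
  have hcard := Nat.card_le_card_of_injective F hF
  simpa [Nat.card_prod, Nat.card_coe_set_eq] using hcard

theorem card_copy_mul_two_pow_le (hT : T.Preconnected) {n m : ℕ} (hn : 0 < n)
    (hm : ∀ f : Copy T (hypercube n), (directions f).card ≤ m) :
    Nat.card (Copy T (hypercube n)) * 2 ^ m ≤
      2 ^ n * (n.choose m * (copiesWithDirections T m m).ncard +
        n ^ (m - 1) * ∑ j ∈ Finset.range m, (copiesWithDirections T j j).ncard * 2 ^ m) := by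
  have hfiber : Nat.card (Copy T (hypercube n)) =
      ∑ j ∈ Finset.range (m + 1), (copiesWithDirections T n j).ncard := by
    have := Fintype.ofFinite (Copy T (hypercube n))
    rw [Nat.card_eq_fintype_card, ← Finset.card_univ, Finset.card_eq_sum_card_fiberwise
      fun f _ => Finset.mem_coe.2 (Finset.mem_range_succ_iff.2 (hm f))]
    refine Finset.sum_congr rfl fun j _ => ?_
    rw [← Set.ncard_coe_finset]
    simp [copiesWithDirections]
  have hfew j (hj : j ∈ Finset.range m) : (copiesWithDirections T n j).ncard * 2 ^ m ≤
      2 ^ n * n ^ (m - 1) * ((copiesWithDirections T j j).ncard * 2 ^ m) :=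
    calc (copiesWithDirections T n j).ncard * 2 ^ m
        ≤ (copiesWithDirections T n j).ncard * 2 ^ j * 2 ^ m :=
          Nat.mul_le_mul_right _ (Nat.le_mul_of_pos_right _ (by positivity))
      _ ≤ n.choose j * (2 ^ n * (copiesWithDirections T j j).ncard) * 2 ^ m :=
          Nat.mul_le_mul_right _ (ncard_copiesWithDirections_mul_two_pow_le hT n j)
      _ ≤ n ^ (m - 1) * (2 ^ n * (copiesWithDirections T j j).ncard) * 2 ^ m := by
          gcongr
          exact (Nat.choose_le_pow n j).trans
            (Nat.pow_le_pow_right hn (Nat.le_sub_one_of_lt (Finset.mem_range.1 hj)))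
      _ = _ := by ring
  rw [hfiber, Finset.sum_range_succ, add_mul, Finset.sum_mul, add_comm, mul_add]
  refine add_le_add ?_ ?_
  · exact (ncard_copiesWithDirections_mul_two_pow_le hT n m).trans_eq (by ring)
  · rw [← mul_assoc, Finset.mul_sum]
    exact Finset.sum_le_sum hfew

end Counting

section Cycles

variable {m : ℕ}

theorem val_finRotate (a : Fin m) :
    (finRotate m a : ℕ) = if (a : ℕ) + 1 = m then 0 else (a : ℕ) + 1 := by
  obtain _ | m := m
  · exact a.elim0
  · rw [coe_finRotate]
    simp [Fin.ext_iff]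

theorem finRotate_induction {P : Fin m → Prop} {a : Fin m} (ha : P a)
    (h : ∀ b, P b → P (finRotate m b)) (b : Fin m) : P b := by
  have : NeZero m := a.neZero
  have hb : (finRotate m)^[(b - a).1] a = b := by
    rw [← finCycle_eq_finRotate_iterate, finCycle_apply, add_sub_cancel]
  exact hb ▸ Function.Iterate.rec P ha h _

theorem cycleGraph_adj_iff_finRotate (hm : 2 ≤ m) {u v : Fin m} :
    (cycleGraph m).Adj u v ↔ v = finRotate m u ∨ u = finRotate m v := by
  obtain ⟨m, rfl⟩ := Nat.exists_eq_add_of_le' hm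
  rw [cycleGraph_adj, finRotate_apply, finRotate_apply, sub_eq_iff_eq_add',
    sub_eq_iff_eq_add', or_comm, add_comm v, add_comm u]

theorem cycleGraph_adj_finRotate (hm : 2 ≤ m) (a : Fin m) :
    (cycleGraph m).Adj a (finRotate m a) :=
  (cycleGraph_adj_iff_finRotate hm).2 (.inl rfl)

/-- The labelled copy of `C_m` traced by `m` distinct vertices with consecutive ones adjacent. -/
def cycleCopy {V : Type*} {G : SimpleGraph V} (hm : 2 ≤ m) (v : Fin m → V)
    (hinj : Function.Injective v) (hv : ∀ a, G.Adj (v a) (v (finRotate m a))) :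
    Copy (cycleGraph m) G where
  toHom := ⟨v, fun {a b} hab => by
    rcases (cycleGraph_adj_iff_finRotate hm).1 hab with rfl | rfl
    exacts [hv a, (hv b).symm]⟩
  injective' := hinj

theorem eq_of_cycleGraph_adj (hm : 2 ≤ m) {u v w x : Fin m} (hv : (cycleGraph m).Adj u v)
    (hw : (cycleGraph m).Adj u w) (hx : (cycleGraph m).Adj u x) (hwv : w ≠ v) (hxv : x ≠ v) :
    w = x := by
  rw [cycleGraph_adj_iff_finRotate hm] at hv hw hx
  have hinj := (finRotate m).injective
  grind [Function.Injective]

theorem finRotate_finRotate_ne (hm : 3 ≤ m) (a : Fin m) : finRotate m (finRotate m a) ≠ a := by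
  rw [Ne, Fin.ext_iff, val_finRotate, val_finRotate]
  split_ifs <;> omega

theorem cycleGraph_aut_ext (hm : 3 ≤ m) {φ ψ : cycleGraph m ≃g cycleGraph m} {a : Fin m}
    (h : φ a = ψ a) (h' : φ (finRotate m a) = ψ (finRotate m a)) : φ = ψ := by
  suffices hall : ∀ b, φ b = ψ b ∧ φ (finRotate m b) = ψ (finRotate m b) from
    DFunLike.ext _ _ fun b => (hall b).1
  refine finRotate_induction ⟨h, h'⟩ fun b hb => ⟨hb.2, ?_⟩
  have hadj (χ : cycleGraph m ≃g cycleGraph m) (c : Fin m) :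
      (cycleGraph m).Adj (χ c) (χ (finRotate m c)) :=
    χ.map_rel_iff.2 (cycleGraph_adj_finRotate (by omega) c)
  have hne (χ : cycleGraph m ≃g cycleGraph m) : χ (finRotate m (finRotate m b)) ≠ χ b :=
    χ.injective.ne (finRotate_finRotate_ne hm b)
  refine eq_of_cycleGraph_adj (by omega) (hadj φ b).symm (hadj φ _) ?_ (hne φ) ?_
  · exact hb.2 ▸ hadj ψ _
  · exact hb.1 ▸ hne ψ

theorem card_cycleGraph_dart (hm : 3 ≤ m) : Nat.card (cycleGraph m).Dart = 2 * m := by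
  obtain ⟨m, rfl⟩ := Nat.exists_eq_add_of_le' hm
  rw [Nat.card_eq_fintype_card, dart_card_eq_sum_degrees]
  simp [cycleGraph_degree_three_le, mul_comm]

theorem card_aut_cycleGraph_le (hm : 3 ≤ m) :
    Nat.card (cycleGraph m ≃g cycleGraph m) ≤ 2 * m := by
  let a : Fin m := ⟨0, by omega⟩
  let d : (cycleGraph m).Dart := ⟨(a, finRotate m a), cycleGraph_adj_finRotate (by omega) a⟩
  rw [← card_cycleGraph_dart hm]
  refine Nat.card_le_card_of_injective (fun φ => φ.toHom.mapDart d) fun φ ψ h => ?_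
  have hd := congrArg Dart.toProd h
  exact cycleGraph_aut_ext hm (congrArg Prod.fst hd) (congrArg Prod.snd hd)

end Cycles

section CyclesInCube

variable {m n : ℕ}

theorem exists_ne_apply_finRotate_ne {α : Type*} {g : Fin m → α} {a : Fin m}
    (h : g a ≠ g (finRotate m a)) : ∃ b ≠ a, g b ≠ g (finRotate m b) := by
  by_contra! hconst
  refine h (finRotate_induction (P := fun b => g b = g (finRotate m a)) rfl (fun b hb => ?_) a)
  by_cases hba : b = a
  · rw [hba]
  · rw [← hconst b hba, hb]

theorem mem_directions_cycleGraph_iff (hm : 2 ≤ m) {f : Copy (cycleGraph m) (hypercube n)}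
    {i : Fin n} : i ∈ directions f ↔ ∃ a, f a i ≠ f (finRotate m a) i := by
  rw [mem_directions]
  constructor
  · rintro ⟨a, b, hab, hi⟩
    rcases (cycleGraph_adj_iff_finRotate hm).1 hab with rfl | rfl
    exacts [⟨a, hi⟩, ⟨b, hi.symm⟩]
  · exact fun ⟨a, hi⟩ => ⟨a, _, cycleGraph_adj_finRotate hm a, hi⟩

theorem two_mul_card_directions_le (hm : 2 ≤ m) (f : Copy (cycleGraph m) (hypercube n)) :
    2 * (directions f).card ≤ m := by
  choose d hd using fun a => hypercube_adj_iff.1 (f.toHom.map_adj (cycleGraph_adj_finRotate hm a))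
  have hd_iff {a i} : f a i ≠ f (finRotate m a) i ↔ d a = i := by
    change _ ≠ f.toHom (finRotate m a) i ↔ _
    rw [hd, ne_comm, eq_comm]
    exact flipBit_apply_ne_iff _
  have hmaps a (_ : a ∈ Finset.univ) : d a ∈ directions f :=
    (mem_directions_cycleGraph_iff hm).2 ⟨a, hd_iff.2 rfl⟩
  have htwice i (hi : i ∈ directions f) : 2 ≤ (Finset.univ.filter fun a => d a = i).card := by
    obtain ⟨a, ha⟩ := (mem_directions_cycleGraph_iff hm).1 hi
    obtain ⟨b, hba, hb⟩ := exists_ne_apply_finRotate_ne (g := fun a => f a i) ha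
    exact Finset.one_lt_card.2 ⟨b, by simpa using hd_iff.1 hb, a, by simpa using hd_iff.1 ha, hba⟩
  simpa using Finset.mul_card_image_le_card_of_maps_to hmaps 2 htwice

theorem ncard_copiesWithDirections_cycleGraph (k ℓ : ℕ) :
    (copiesWithDirections (cycleGraph (2 * ℓ)) k k).ncard =
      cubeCycleCount k ℓ * Nat.card (cycleGraph (2 * ℓ) ≃g cycleGraph (2 * ℓ)) := by
  rw [cubeCycleCount, ← ncard_copy_toSubgraph _ _ fun S => (starPositions S).ncard = k]
  simp only [starPositions_toSubgraph, Set.ncard_coe_finset]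
  rfl

end CyclesInCube

section Zigzag

variable {ℓ n : ℕ}

/-- The `a`-th vertex of the zigzag cycle of length `2 * ℓ`, which alternates between the
singletons `{i}` and the cyclically consecutive pairs `{i, i + 1}`. The last clause is the
wrap-around, in the pair `{ℓ - 1, 0}`. -/
def zigzagVertex (ℓ : ℕ) (a : Fin (2 * ℓ)) (j : Fin ℓ) : Bool :=
  decide ((j : ℕ) = a / 2 ∨ (j : ℕ) = (a + 1) / 2 ∨ ((j : ℕ) = 0 ∧ ((a : ℕ) + 1) / 2 = ℓ))

theorem zigzagVertex_finRotate_of_odd (hℓ : 2 ≤ ℓ) {a : Fin (2 * ℓ)} {i : Fin ℓ}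
    (ha : (a : ℕ) = 2 * i + 1) :
    zigzagVertex ℓ (finRotate _ a) = flipBit (zigzagVertex ℓ a) i := by
  ext j
  have hj := j.2
  rw [flipBit_apply]
  simp only [zigzagVertex, val_finRotate, ← decide_not, Fin.ext_iff, ha]
  split_ifs <;> rw [decide_eq_decide] <;> omega

theorem exists_zigzagVertex_finRotate_of_even (hℓ : 2 ≤ ℓ) {a : Fin (2 * ℓ)}
    (ha : (a : ℕ) % 2 = 0) :
    ∃ i, zigzagVertex ℓ (finRotate _ a) = flipBit (zigzagVertex ℓ a) i := by
  refine ⟨⟨if (a : ℕ) / 2 + 1 = ℓ then 0 else a / 2 + 1, by split_ifs <;> omega⟩, ?_⟩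
  ext j
  have hj := j.2
  rw [flipBit_apply]
  simp only [zigzagVertex, val_finRotate, ← decide_not, Fin.ext_iff]
  split_ifs <;> rw [decide_eq_decide] <;> omega

theorem zigzagVertex_adj (hℓ : 2 ≤ ℓ) (a : Fin (2 * ℓ)) :
    (hypercube ℓ).Adj (zigzagVertex ℓ a) (zigzagVertex ℓ (finRotate _ a)) := by
  rw [hypercube_adj_iff]
  rcases Nat.mod_two_eq_zero_or_one a with ha | ha
  · exact exists_zigzagVertex_finRotate_of_even hℓ ha
  · exact ⟨⟨a / 2, by omega⟩, zigzagVertex_finRotate_of_odd hℓ (by simp only; omega)⟩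

theorem zigzagVertex_injective (hℓ : 3 ≤ ℓ) : Function.Injective (zigzagVertex ℓ) := by
  intro a b h
  have ha := a.2
  have hb := b.2
  have hval (j : ℕ) (hj : j < ℓ) := congrFun h ⟨j, hj⟩
  simp only [zigzagVertex, decide_eq_decide] at hval
  have h₁ := hval (a / 2) (by omega)
  have h₂ := hval (b / 2) (by omega)
  have h₃ := hval 0 (by omega)
  have h₄ : (a : ℕ) / 2 + 1 < ℓ → _ := hval (a / 2 + 1)
  have h₅ : (b : ℕ) / 2 + 1 < ℓ → _ := hval (b / 2 + 1)
  rw [Fin.ext_iff]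
  omega

theorem bitWeight_zigzagVertex (hℓ : 2 ≤ ℓ) (a : Fin (2 * ℓ)) :
    bitWeight (zigzagVertex ℓ a) = 1 + a % 2 := by
  have halt := a.2
  rcases Nat.mod_two_eq_zero_or_one a with ha | ha
  · rw [ha, bitWeight, Finset.card_eq_one]
    refine ⟨⟨a / 2, by omega⟩, ?_⟩
    ext j
    simp only [zigzagVertex, decide_eq_true_eq, Finset.mem_filter_univ, Finset.mem_singleton,
      Fin.ext_iff]
    omega
  · rw [ha, bitWeight, Finset.card_eq_two]
    refine ⟨⟨a / 2, by omega⟩,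
      ⟨if (a : ℕ) / 2 + 1 = ℓ then 0 else a / 2 + 1, by split_ifs <;> omega⟩, ?_, ?_⟩
    · rw [Ne, Fin.mk.injEq]
      split_ifs <;> omega
    · ext j
      have hj := j.2
      simp only [zigzagVertex, decide_eq_true_eq, Finset.mem_filter_univ, Finset.mem_insert,
        Finset.mem_singleton, Fin.ext_iff]
      split_ifs <;> omega

/-- The embedding of the zigzag cycle in the subcube of `Q_n` spanned by the coordinates `σ i`,
the remaining coordinates being fixed as in `x`. -/
noncomputable def zigzagCopy (hℓ : 3 ≤ ℓ) (σ : Fin ℓ ↪ Fin n) (x : Fin n → Bool) :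
    Copy (cycleGraph (2 * ℓ)) (hypercube n) :=
  (subcubeCopy σ x).comp (cycleCopy (by omega) (zigzagVertex ℓ) (zigzagVertex_injective hℓ)
    (zigzagVertex_adj (by omega)))

theorem zigzagCopy_apply (hℓ : 3 ≤ ℓ) (σ : Fin ℓ ↪ Fin n) (x : Fin n → Bool)
    (a : Fin (2 * ℓ)) :
    zigzagCopy hℓ σ x a = Function.extend σ (zigzagVertex ℓ a) x := rfl

theorem exists_bitWeight_zigzagCopy (hℓ : 3 ≤ ℓ) (σ : Fin ℓ ↪ Fin n) (x : Fin n → Bool) :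
    ∃ c, ∀ a, bitWeight (zigzagCopy hℓ σ x a) = c + a % 2 := by
  obtain ⟨c, hc⟩ := bitWeight_extend σ x
  exact ⟨c + 1, fun a => by
    rw [zigzagCopy_apply, hc, bitWeight_zigzagVertex (by omega), add_assoc]⟩

theorem ncard_edgeLevels_zigzagCopy_le (hℓ : 3 ≤ ℓ) (σ : Fin ℓ ↪ Fin n) (x : Fin n → Bool) :
    (edgeLevels (zigzagCopy hℓ σ x)).ncard ≤ 1 := by
  obtain ⟨c, hc⟩ := exists_bitWeight_zigzagCopy hℓ σ x
  have hlevel a :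
      edgeLevel (zigzagCopy hℓ σ x a) (zigzagCopy hℓ σ x (finRotate _ a)) = c := by
    rw [edgeLevel, hc, hc, val_finRotate]
    split_ifs <;> omega
  refine (Set.ncard_le_ncard (t := {c}) ?_ (Set.finite_singleton c)).trans
    (Set.ncard_singleton c).le
  rintro _ ⟨a, b, hab, rfl⟩
  rcases (cycleGraph_adj_iff_finRotate (by omega)).1 hab with rfl | rfl
  · exact hlevel a
  · exact (edgeLevel_comm _ _).trans (hlevel b)

theorem zigzagCopy_finRotate_of_odd (hℓ : 3 ≤ ℓ) (σ : Fin ℓ ↪ Fin n) (x : Fin n → Bool)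
    {a : Fin (2 * ℓ)} {i : Fin ℓ} (ha : (a : ℕ) = 2 * i + 1) :
    zigzagCopy hℓ σ x (finRotate _ a) = flipBit (zigzagCopy hℓ σ x a) (σ i) := by
  rw [zigzagCopy_apply, zigzagVertex_finRotate_of_odd (by omega) ha, extend_flipBit,
    zigzagCopy_apply]

theorem eq_and_eq_of_zigzagCopy_eq (hℓ : 3 ≤ ℓ) {σ τ : Fin ℓ ↪ Fin n} {x y : Fin n → Bool}
    (h : zigzagCopy hℓ σ x = zigzagCopy hℓ τ y) (hxy : x ∘ σ = y ∘ τ) :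
    σ = τ ∧ x = y := by
  obtain rfl : σ = τ := by
    ext i : 1
    have hi := i.2
    have ha : ((⟨2 * i + 1, by omega⟩ : Fin (2 * ℓ)) : ℕ) = 2 * i + 1 := rfl
    refine flipBit_injective _ ((zigzagCopy_finRotate_of_odd hℓ σ x ha).symm.trans ?_)
    rw [h, zigzagCopy_finRotate_of_odd hℓ τ y ha]
  refine ⟨rfl, ?_⟩
  have h₀ := DFunLike.congr_fun h ⟨0, by omega⟩
  rw [zigzagCopy_apply, zigzagCopy_apply] at h₀
  rw [← extend_comp_self σ x, ← extend_extend, h₀, extend_extend, hxy, extend_comp_self]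

theorem edgeLevels_comp_subset {U U' : Type*} {T : SimpleGraph U} {T' : SimpleGraph U'}
    (f : Copy T (hypercube n)) (g : Copy T' T) : edgeLevels (f.comp g) ⊆ edgeLevels f :=
  fun _ ⟨_, _, hab, h⟩ => ⟨_, _, g.toHom.map_adj hab, h⟩

/-- The rotation of `C_m` by one step. -/
def cycleRotation {m : ℕ} (hm : 2 ≤ m) : Copy (cycleGraph m) (cycleGraph m) :=
  cycleCopy hm (finRotate m) (finRotate m).injective fun _ => cycleGraph_adj_finRotate hm _

theorem zigzagCopy_ne_comp_cycleRotation (hℓ : 3 ≤ ℓ) (σ τ : Fin ℓ ↪ Fin n)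
    (x y : Fin n → Bool) :
    zigzagCopy hℓ σ x ≠ (zigzagCopy hℓ τ y).comp (cycleRotation (by omega)) := by
  intro h
  obtain ⟨c, hc⟩ := exists_bitWeight_zigzagCopy hℓ σ x
  obtain ⟨d, hd⟩ := exists_bitWeight_zigzagCopy hℓ τ y
  have hval (a : Fin (2 * ℓ)) : c + a % 2 = d + (finRotate _ a : ℕ) % 2 := by
    rw [← hc, ← hd, h]
    rfl
  have h₀ := hval ⟨0, by omega⟩
  have h₁ := hval ⟨1, by omega⟩
  simp only [val_finRotate] at h₀ h₁
  split_ifs at h₀ h₁ <;> omega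

theorem descFactorial_mul_le_ncard_edgeLevels_le_one (hℓ : 3 ≤ ℓ) (n : ℕ) :
    n.descFactorial ℓ * (2 ^ n * 2) ≤
      {f : Copy (cycleGraph (2 * ℓ)) (hypercube n) | (edgeLevels f).ncard ≤ 1}.ncard * 2 ^ ℓ := by
  let X := {f : Copy (cycleGraph (2 * ℓ)) (hypercube n) | (edgeLevels f).ncard ≤ 1}
  let F (p : (Fin ℓ ↪ Fin n) × (Fin n → Bool) × Bool) : X × (Fin ℓ → Bool) :=
    ⟨bif p.2.2 then
        ⟨(zigzagCopy hℓ p.1 p.2.1).comp (cycleRotation (by omega)),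
          (Set.ncard_le_ncard (edgeLevels_comp_subset _ _) (finite_edgeLevels _)).trans
            (ncard_edgeLevels_zigzagCopy_le hℓ p.1 p.2.1)⟩
      else ⟨zigzagCopy hℓ p.1 p.2.1, ncard_edgeLevels_zigzagCopy_le hℓ p.1 p.2.1⟩,
    p.2.1 ∘ p.1⟩
  have hF : Function.Injective F := by
    rintro ⟨σ, x, b⟩ ⟨τ, y, c⟩ h
    obtain ⟨hX, hxy⟩ := Prod.ext_iff.1 h
    have hf := congrArg Subtype.val hX
    cases b <;> cases c
    · obtain ⟨rfl, rfl⟩ := eq_and_eq_of_zigzagCopy_eq hℓ hf hxy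
      rfl
    · exact absurd hf (zigzagCopy_ne_comp_cycleRotation hℓ σ τ x y)
    · exact absurd hf.symm (zigzagCopy_ne_comp_cycleRotation hℓ τ σ y x)
    · obtain ⟨rfl, rfl⟩ := eq_and_eq_of_zigzagCopy_eq hℓ
        (Copy.ext ((finRotate _).surjective.forall.2 (DFunLike.congr_fun hf))) hxy
      rfl
  have hcard := Nat.card_le_card_of_injective F hF
  simpa [Nat.card_prod, Nat.card_coe_set_eq, Nat.card_eq_fintype_card (α := Fin ℓ ↪ Fin n), X]
    using hcard

end Zigzag

section Density

variable {ℓ n k : ℕ}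

theorem exists_cycleGraph_adj (hℓ : 2 ≤ ℓ) (a : Fin (2 * ℓ)) : ∃ b, (cycleGraph (2 * ℓ)).Adj a b :=
  ⟨_, cycleGraph_adj_finRotate (by omega) a⟩

theorem nonempty_copy_cycleGraph (hℓ : 2 ≤ ℓ) (hn : ℓ ≤ n) :
    Nonempty (Copy (cycleGraph (2 * ℓ)) (hypercube n)) := by
  rcases hℓ.eq_or_lt with rfl | hℓ
  · let v : Fin (2 * 2) → Fin 2 → Bool :=
      ![![false, false], ![true, false], ![true, true], ![false, true]]
    have hadj : ∀ a, hammingDist (v a) (v (finRotate _ a)) = 1 := by decide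
    exact ⟨(subcubeCopy (Fin.castLEEmb hn) fun _ => false).comp
      (cycleCopy (by norm_num) v (by decide) hadj)⟩
  · exact ⟨zigzagCopy hℓ (Fin.castLEEmb hn) fun _ => false⟩

theorem card_directions_le (hℓ : 2 ≤ ℓ) (f : Copy (cycleGraph (2 * ℓ)) (hypercube n)) :
    (directions f).card ≤ ℓ := by
  have := two_mul_card_directions_le (by omega) f
  omega

theorem one_sub_div_le_genTuranDensity (hk : 0 < k) (hℓ : 2 ≤ ℓ) (hn : ℓ ≤ n) :
    1 - (ℓ : ℝ) / k ≤ genTuranDensity (hypercube n) (cycleGraph (2 * ℓ)) (hypercube k) := by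
  have hlevels (f : Copy (cycleGraph (2 * ℓ)) (hypercube n)) : (edgeLevels f).ncard ≤ ℓ :=
    (ncard_edgeLevels_le cycleGraph_preconnected f).trans (card_directions_le hℓ f)
  have : Nonempty (Copy (cycleGraph (2 * ℓ)) (hypercube n)) := nonempty_copy_cycleGraph hℓ hn
  have hcard : (Nat.card (Copy (cycleGraph (2 * ℓ)) (hypercube n)) : ℝ) ≠ 0 :=
    Nat.cast_ne_zero.2 Nat.card_pos.ne'
  simpa [Set.ncard_univ, hcard] using one_sub_mul_le_genTuranDensity (exists_cycleGraph_adj hℓ) hk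
    (X := Set.univ) fun f _ => hlevels f

theorem exists_card_copy_cycleGraph_mul_le (hℓ : 2 ≤ ℓ) :
    ∃ K : ℕ, ∀ n > 0, Nat.card (Copy (cycleGraph (2 * ℓ)) (hypercube n)) * 2 ^ ℓ ≤
      2 ^ n * (n.choose ℓ * (cubeCycleCount ℓ ℓ * (4 * ℓ)) + n ^ (ℓ - 1) * K) := by
  have : Nonempty (Fin (2 * ℓ)) := ⟨⟨0, by omega⟩⟩
  refine ⟨∑ j ∈ Finset.range ℓ, (copiesWithDirections (cycleGraph (2 * ℓ)) j j).ncard * 2 ^ ℓ,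
    fun n hn => (card_copy_mul_two_pow_le cycleGraph_preconnected hn
    (card_directions_le hℓ)).trans ?_⟩
  gcongr
  rw [ncard_copiesWithDirections_cycleGraph]
  gcongr
  exact (card_aut_cycleGraph_le (by omega)).trans (by omega)

theorem pow_le_choose_mul (h : 2 * ℓ ≤ n) : n ^ ℓ ≤ n.choose ℓ * (2 ^ ℓ * ℓ.factorial) :=
  calc n ^ ℓ ≤ (2 * (n + 1 - ℓ)) ^ ℓ := Nat.pow_le_pow_left (by omega) _
    _ = 2 ^ ℓ * (n + 1 - ℓ) ^ ℓ := mul_pow _ _ _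
    _ ≤ 2 ^ ℓ * n.descFactorial ℓ := Nat.mul_le_mul_left _ (Nat.pow_sub_le_descFactorial _ _)
    _ = _ := by rw [Nat.descFactorial_eq_factorial_mul_choose]; ring

theorem exists_card_copy_cycleGraph_le (hℓ : 2 ≤ ℓ) (hz : 0 < cubeCycleCount ℓ ℓ) :
    ∃ C : ℝ, 0 ≤ C ∧ ∀ n ≥ 2 * ℓ,
      (Nat.card (Copy (cycleGraph (2 * ℓ)) (hypercube n)) * 2 ^ ℓ : ℝ) ≤
        (1 + C / n) * (2 ^ n * (n.choose ℓ * (cubeCycleCount ℓ ℓ * (4 * ℓ)))) := by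
  obtain ⟨K, hK⟩ := exists_card_copy_cycleGraph_mul_le hℓ
  refine ⟨2 ^ ℓ * ℓ.factorial * K, by positivity, fun n hn => ?_⟩
  set z := cubeCycleCount ℓ ℓ
  have hn₀ : (0 : ℝ) < n := Nat.cast_pos.2 (by omega)
  have hz₁ : (1 : ℝ) ≤ z * (4 * ℓ) := by exact_mod_cast (by positivity : 0 < z * (4 * ℓ))
  have hfew : (n ^ (ℓ - 1) * K : ℝ) ≤
      2 ^ ℓ * ℓ.factorial * K / n * (n.choose ℓ * (z * (4 * ℓ))) :=
    calc (n ^ (ℓ - 1) * K : ℝ) = n ^ ℓ * K / n := by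
          rw [eq_div_iff hn₀.ne', ← pow_sub_one_mul (by omega : ℓ ≠ 0)]; ring
      _ ≤ n.choose ℓ * (2 ^ ℓ * ℓ.factorial) * K / n := by
          gcongr
          exact_mod_cast pow_le_choose_mul hn
      _ = 2 ^ ℓ * ℓ.factorial * K / n * (n.choose ℓ * 1) := by ring
      _ ≤ _ := by gcongr
  calc (Nat.card (Copy (cycleGraph (2 * ℓ)) (hypercube n)) * 2 ^ ℓ : ℝ)
      ≤ 2 ^ n * (n.choose ℓ * (z * (4 * ℓ)) + n ^ (ℓ - 1) * K) := by
        exact_mod_cast hK n (by omega)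
    _ ≤ 2 ^ n * (n.choose ℓ * (z * (4 * ℓ)) +
          2 ^ ℓ * ℓ.factorial * K / n * (n.choose ℓ * (z * (4 * ℓ)))) := by gcongr
    _ = _ := by ring

theorem exists_factorial_div_mul_le_ncard_div (hℓ : 3 ≤ ℓ) :
    ∃ C : ℝ, 0 ≤ C ∧ ∀ n ≥ 2 * ℓ,
      ((ℓ - 1).factorial : ℝ) / (2 * cubeCycleCount ℓ ℓ) * (1 - C / n) ≤
        {f : Copy (cycleGraph (2 * ℓ)) (hypercube n) | (edgeLevels f).ncard ≤ 1}.ncard /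
          Nat.card (Copy (cycleGraph (2 * ℓ)) (hypercube n)) := by
  rcases Nat.eq_zero_or_pos (cubeCycleCount ℓ ℓ) with hz | hz
  · refine ⟨0, le_rfl, fun n _ => ?_⟩
    rw [hz, Nat.cast_zero, mul_zero, div_zero, zero_mul]
    positivity
  obtain ⟨C, hC, hcard⟩ := exists_card_copy_cycleGraph_le (by omega) hz
  refine ⟨C, hC, fun n hn => ?_⟩
  have hzigzag := descFactorial_mul_le_ncard_edgeLevels_le_one hℓ n
  have : Nonempty (Copy (cycleGraph (2 * ℓ)) (hypercube n)) :=
    nonempty_copy_cycleGraph (by omega) (by omega)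
  set X := {f : Copy (cycleGraph (2 * ℓ)) (hypercube n) | (edgeLevels f).ncard ≤ 1}
  set z := cubeCycleCount ℓ ℓ
  set ε := C / n
  have hε : 0 ≤ ε := by positivity
  have hinv : 1 - ε ≤ (1 + ε)⁻¹ := by
    rw [← one_div, le_div_iff₀ (by positivity)]
    nlinarith [sq_nonneg ε]
  have hfact : (ℓ.factorial : ℝ) = ℓ * (ℓ - 1).factorial := by
    exact_mod_cast (Nat.mul_factorial_pred (by omega)).symm
  rw [le_div_iff₀ (Nat.cast_pos.2 Nat.card_pos)]
  refine le_of_mul_le_mul_right ?_ (by positivity : (0 : ℝ) < 2 ^ ℓ)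
  calc ((ℓ - 1).factorial : ℝ) / (2 * z) * (1 - ε) *
        Nat.card (Copy (cycleGraph (2 * ℓ)) (hypercube n)) * 2 ^ ℓ
      ≤ ((ℓ - 1).factorial : ℝ) / (2 * z) * (1 + ε)⁻¹ *
        Nat.card (Copy (cycleGraph (2 * ℓ)) (hypercube n)) * 2 ^ ℓ := by gcongr
    _ ≤ ((ℓ - 1).factorial : ℝ) / (2 * z) * (1 + ε)⁻¹ *
        ((1 + ε) * (2 ^ n * (n.choose ℓ * (z * (4 * ℓ))))) := by
        rw [mul_assoc _ (Nat.card _ : ℝ)]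
        exact mul_le_mul_of_nonneg_left (hcard n hn) (by positivity)
    _ = n.descFactorial ℓ * (2 ^ n * 2) := by
        rw [Nat.descFactorial_eq_factorial_mul_choose, Nat.cast_mul, hfact]
        field_simp
        ring
    _ ≤ X.ncard * 2 ^ ℓ := by exact_mod_cast hzigzag

theorem one_sub_div_mul_le_one_sub_two_div (hk : 3 ≤ k) (z : ℕ) :
    (1 - 1 / k : ℝ) * (1 / (2 * z)) ≤ 1 - 2 / k := by
  have hk₃ : (3 : ℝ) ≤ k := by exact_mod_cast hk
  have hz : (1 : ℝ) / (2 * z) ≤ 1 / 2 := by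
    rcases Nat.eq_zero_or_pos z with rfl | hz
    · norm_num
    · have : (1 : ℝ) ≤ z := by exact_mod_cast hz
      gcongr
      linarith
  have hk₁ : 1 / (k : ℝ) ≤ 1 / 3 := by gcongr
  calc (1 - 1 / k : ℝ) * (1 / (2 * z)) ≤ (1 - 1 / k) * (1 / 2) := by gcongr; linarith
    _ ≤ 1 - 2 / k := by
      rw [← mul_one_div 2 (k : ℝ)]
      linarith

theorem exists_factorial_div_mul_le_genTuranDensity (hk : 2 ≤ k) (hℓ : 2 ≤ ℓ)
    (hkℓ : ¬(k = 2 ∧ ℓ = 2)) :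
    ∃ C : ℝ, 0 ≤ C ∧ ∀ n ≥ 2 * ℓ,
      (1 - 1 / (k : ℝ)) * (((ℓ - 1).factorial : ℝ) / (2 * (cubeCycleCount ℓ ℓ : ℝ))) *
        (1 - C / n) ≤ genTuranDensity (hypercube n) (cycleGraph (2 * ℓ)) (hypercube k) := by
  rcases hℓ.eq_or_lt with rfl | hℓ
  · refine ⟨0, le_rfl, fun n hn => ?_⟩
    have h := one_sub_div_mul_le_one_sub_two_div (by omega : 3 ≤ k) (cubeCycleCount 2 2)
    simpa using h.trans (one_sub_div_le_genTuranDensity (by omega) le_rfl (by omega : 2 ≤ n))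
  · obtain ⟨C, hC, hle⟩ := exists_factorial_div_mul_le_ncard_div hℓ
    refine ⟨C, hC, fun n hn => ?_⟩
    have hk₁ : 0 ≤ 1 - 1 / (k : ℝ) :=
      sub_nonneg.2 (div_le_one_of_le₀ (by exact_mod_cast (by omega : 1 ≤ k)) (Nat.cast_nonneg k))
    rw [mul_assoc]
    refine (mul_le_mul_of_nonneg_left (hle n hn) hk₁).trans ?_
    simpa using one_sub_mul_le_genTuranDensity (exists_cycleGraph_adj hℓ.le) (by omega : 0 < k)
      (X := {f | (edgeLevels f).ncard ≤ 1}) fun f hf => hf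

end Density

theorem theorem5 :
    ∃ α : ℝ, 0 < α ∧
      ∀ k ℓ : ℕ, 2 ≤ k → 2 ≤ ℓ → ¬ (k = 2 ∧ ℓ = 2) →
        ∃ ε : ℕ → ℝ, (∀ n, 0 ≤ ε n) ∧ Tendsto ε atTop (𝓝 0) ∧
          ∀ᶠ n : ℕ in atTop,
            max ((1 - 1 / (k : ℝ)) *
                  (((ℓ - 1).factorial : ℝ) / (2 * (cubeCycleCount ℓ ℓ : ℝ))) * (1 - ε n))
                (1 - (ℓ : ℝ) / (k : ℝ))
              ≤ genTuranDensity (hypercube n) (SimpleGraph.cycleGraph (2 * ℓ)) (hypercube k) ∧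
            genTuranDensity (hypercube n) (SimpleGraph.cycleGraph (2 * ℓ)) (hypercube k)
              ≤ 1 - α * (Real.log (k : ℝ) / ((k : ℝ) * 2 ^ k)) := by
  refine ⟨1 / 8, by norm_num, fun k ℓ hk hℓ hkℓ => ?_⟩
  obtain ⟨C, hC, hfirst⟩ := exists_factorial_div_mul_le_genTuranDensity hk hℓ hkℓ
  refine ⟨fun n => C / n, fun n => by positivity, tendsto_const_div_atTop_nhds_zero_nat C, ?_⟩
  filter_upwards [eventually_ge_atTop (2 * ℓ), eventually_ge_atTop (k + 2)] with n hn hnk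
  have : Nonempty (Fin (2 * ℓ)) := ⟨⟨0, by omega⟩⟩
  exact ⟨max_le (hfirst n hn) (one_sub_div_le_genTuranDensity (by omega) hℓ (by omega)),
    genTuranDensity_hypercube_le (exists_cycleGraph_adj hℓ) hk hnk⟩
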